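/- Let $k$ be an algebraically closed field and let $A$ be a finite dimensional $k$-algebra that is an RFS algebra, that is, $A$ is indecomposable (as an algebra), basic, representation-finite, self-injective and not isomorphic to $k$. Let $A\text{-}\underline{\mathrm{mod}}$ be the stable category of finite dimensional left $A$-modules, with morphism spaces $\underline{\mathrm{Hom}}_A(X,Y)$ equal to $\mathrm{Hom}_A(X,Y)$ modulo the maps factoring through projective modules; it is triangulated, with distinguished triangles $X\to Y\to Z\to X[1]=\Omega^{-1}X$ induced by the short exact sequences of $A$-modules. Let $\mathcal S$ be a family of objects of $A\text{-}\underline{\mathrm{mod}}$ such that 1. $\mathcal S$ is an orthogonal system: $\underline{\mathrm{Hom}}_A(M,M)\cong k$ for all $M\in\mathcal S$, and $\underline{\mathrm{Hom}}_A(M,N)=0$ for all distinct $M,N\in\mathcal S$; 2. $\mathcal S$ is Nakayama-stable: the Nakayama functor $\nu=D\,\mathrm{Hom}_A(-,A)$, where $D=\mathrm{Hom}_k(-,k)$, permutes the objects of $\mathcal S$ up to isomorphism in $A\text{-}\underline{\mathrm{mod}}$; 3. ${}^{\perp}\mathcal S^{\perp}=\{0\}$: every object $X$ of $A\text{-}\underline{\mathrm{mod}}$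 with $\underline{\mathrm{Hom}}_A(X,S)=0=\underline{\mathrm{Hom}}_A(S,X)$ for all $S\in\mathcal S$ is zero in $A\text{-}\underline{\mathrm{mod}}$. Then $\mathcal S$ is a simple-minded system, that is, $\mathcal S$ is an orthogonal system and $\mathcal F(\mathcal S)=A\text{-}\underline{\mathrm{mod}}$. Here $\mathcal F(\mathcal S)=\bigcup_{n\ge 0}(\mathcal S)_n$, where $(\mathcal S)_0=\{0\}$ and $(\mathcal S)_n=(\mathcal S)_{n-1}*(\mathcal S\cup\{0\})$ for $n\geq 1$, and $\mathcal S_1*\mathcal S_2$ denotes the family of all objects $Y$ that lie in a distinguished triangle $X\to Y\to Z\to X[1]$ with $X\in\mathcal S_1$ and $Z\in\mathcal S_2$. -/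

import Mathlib

open CategoryTheory CategoryTheory.Limits

universe u

/-- A finite dimensional left module over the `k`-algebra `A`. These are the objects of `A`-mod,
and also the objects of the stable category `A`-stmod. -/
structure StMod (k A : Type u) [Field k] [Ring A] [Algebra k A] where
  /-- The underlying type. -/
  carrier : Type u
  [addCommGroup : AddCommGroup carrier]
  [moduleBase : Module k carrier]
  [module : Module A carrier]
  [isScalarTower : IsScalarTower k A carrier]
  [finite : Module.Finite k carrier]

namespace StMod

attribute [instance] addCommGroup moduleBase module isScalarTower finite

section Category

variable {k A : Type u} [Field k] [Ring A] [Algebra k A]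

instance : CoeSort (StMod k A) (Type u) := ⟨carrier⟩

instance (M : StMod k A) : SMulCommClass A k M := ⟨fun a c m => by
  rw [← algebraMap_smul A c m, ← algebraMap_smul A c (a • m), smul_smul, smul_smul,
    Algebra.commutes c a]⟩

/-- The `k`-subspace of `Hom_A(M, N)` of the maps that factor through a projective module. -/
def projHom (M N : StMod k A) : Submodule k (M →ₗ[A] N) where
  carrier := {f | ∃ (P : StMod k A) (g : M →ₗ[A] P) (h : P →ₗ[A] N),
    Module.Projective A P ∧ f = h ∘ₗ g}
  add_mem' := by
    rintro _ _ ⟨P, g, h, hP, rfl⟩ ⟨P', g', h', hP', rfl⟩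
    exact ⟨⟨P × P'⟩, g.prod g', h.coprod h', inferInstance, by ext; simp⟩
  zero_mem' := ⟨⟨PUnit⟩, 0, 0, inferInstance, by simp⟩
  smul_mem' := by
    rintro c _ ⟨P, g, h, hP, rfl⟩
    exact ⟨P, g, c • h, hP, by ext; simp⟩

lemma comp_mem_projHom_left {L M N : StMod k A} (g : M →ₗ[A] N) {f : L →ₗ[A] M}
    (hf : f ∈ projHom L M) : g ∘ₗ f ∈ projHom L N := by
  obtain ⟨P, a, b, hP, rfl⟩ := hf
  exact ⟨P, a, g ∘ₗ b, hP, rfl⟩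

lemma comp_mem_projHom_right {L M N : StMod k A} {g : M →ₗ[A] N} (f : L →ₗ[A] M)
    (hg : g ∈ projHom M N) : g ∘ₗ f ∈ projHom L N := by
  obtain ⟨P, a, b, hP, rfl⟩ := hg
  exact ⟨P, a ∘ₗ f, b, hP, rfl⟩

/-- The stable morphism space: `Hom_A(M, N)` modulo the maps factoring through projectives. -/
abbrev StHom (M N : StMod k A) : Type u := (M →ₗ[A] N) ⧸ projHom M N

/-- Composition of stable morphisms, induced by composition of module homomorphisms. -/
def stComp {L M N : StMod k A} (f : StHom L M) (g : StHom M N) : StHom L N :=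
  Quotient.liftOn₂' f g (fun f g => (projHom L N).mkQ (g ∘ₗ f)) (by
    intro f g f' g' hf hg
    rw [Submodule.quotientRel_def] at hf hg
    refine (Submodule.Quotient.eq _).2 ?_
    have h : g ∘ₗ f - g' ∘ₗ f' = g ∘ₗ (f - f') + (g - g') ∘ₗ f' := by
      ext; simp
    rw [h]
    exact add_mem (comp_mem_projHom_left g hf) (comp_mem_projHom_right f' hg))

/-- The stable category `A`-stmod. In particular `M ≅ N` denotes isomorphism in `A`-stmod and
`IsZero M` says that `M` is a zero object of `A`-stmod. -/
instance stableCategory : Category (StMod k A) where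
  Hom M N := StHom M N
  id M := (projHom M M).mkQ LinearMap.id
  comp f g := stComp f g
  id_comp := by rintro M N ⟨f⟩; rfl
  comp_id := by rintro M N ⟨f⟩; rfl
  assoc := by rintro K L M N ⟨f⟩ ⟨g⟩ ⟨h⟩; rfl

/-- The stable morphism represented by a module homomorphism. -/
def toStable {M N : StMod k A} (f : M →ₗ[A] N) : M ⟶ N := (projHom M N).mkQ f

instance (M N : StMod k A) : AddCommGroup (M ⟶ N) := inferInstanceAs (AddCommGroup (StHom M N))

instance (M N : StMod k A) : Module k (M ⟶ N) := inferInstanceAs (Module k (StHom M N))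

instance : Preadditive (StMod k A) where
  add_comp := by
    rintro L M N ⟨f⟩ ⟨f'⟩ ⟨g⟩
    exact congrArg (projHom L N).mkQ (LinearMap.comp_add f f' g)
  comp_add := by
    rintro L M N ⟨f⟩ ⟨g⟩ ⟨g'⟩
    exact congrArg (projHom L N).mkQ (LinearMap.add_comp f g' g)

instance : Linear k (StMod k A) where
  smul_comp := by
    rintro L M N c ⟨f⟩ ⟨g⟩
    refine congrArg (projHom L N).mkQ (?_ : g ∘ₗ (c • f) = c • (g ∘ₗ f))
    ext x
    change g (c • f x) = c • g (f x)
    rw [← algebraMap_smul A c (f x), map_smul, algebraMap_smul]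
  comp_smul := by
    rintro L M N ⟨f⟩ c ⟨g⟩
    rfl

/-- The pair `X ⟶ Y ⟶ Z` of stable morphisms is part of a distinguished triangle
`X ⟶ Y ⟶ Z ⟶ X[1]` of `A`-stmod, that is, it is isomorphic in `A`-stmod to the pair induced by
a short exact sequence `0 → X' → Y' → Z' → 0` in `A`-mod. (The third morphism is then supplied by
the exact sequence.) -/
def IsTrianglePair {X Y Z : StMod k A} (f : X ⟶ Y) (g : Y ⟶ Z) : Prop :=
  ∃ (X' Y' Z' : StMod k A) (i : X' →ₗ[A] Y') (p : Y' →ₗ[A] Z'),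
    Function.Injective i ∧ Function.Exact i p ∧ Function.Surjective p ∧
      ∃ (a : X ≅ X') (b : Y ≅ Y') (c : Z ≅ Z'),
        f ≫ b.hom = a.hom ≫ toStable i ∧ g ≫ c.hom = b.hom ≫ toStable p

/-- `P ∗ Q`: the objects `Y` that fit into a distinguished triangle `X ⟶ Y ⟶ Z ⟶ X[1]` with `X`
in `P` and `Z` in `Q`. -/
def star (P Q : ObjectProperty (StMod k A)) : ObjectProperty (StMod k A) := fun Y =>
  ∃ (X Z : StMod k A) (f : X ⟶ Y) (g : Y ⟶ Z), P X ∧ Q Z ∧ IsTrianglePair f g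

/-- `(S)₀ = {0}` and `(S)ₙ₊₁ = (S)ₙ ∗ (S ∪ {0})`. -/
def filtLevel (S : ObjectProperty (StMod k A)) : ℕ → ObjectProperty (StMod k A)
  | 0 => fun X => IsZero X
  | n + 1 => star (filtLevel S n) (fun X => S X ∨ IsZero X)

/-- The extension closure `F(S)`, the union of all `(S)ₙ`. -/
def extClosure (S : ObjectProperty (StMod k A)) : ObjectProperty (StMod k A) := fun X =>
  ∃ n : ℕ, filtLevel S n X

/-- A stable brick: `M` with stable endomorphism space `k`. -/
def IsStableBrick (M : StMod k A) : Prop := Nonempty ((M ⟶ M) ≃ₗ[k] k)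

/-- An orthogonal system: a family of stable bricks without nonzero stable morphisms between
distinct members. -/
structure IsOrthogonalSystem (S : ObjectProperty (StMod k A)) : Prop where
  brick : ∀ M, S M → IsStableBrick M
  orthogonal : ∀ M N, S M → S N → M ≠ N → ∀ f : M ⟶ N, f = 0

/-- A simple-minded system: an orthogonal system whose extension closure is all of `A`-stmod. -/
structure IsSimpleMindedSystem (S : ObjectProperty (StMod k A)) : Prop where
  orthogonal : IsOrthogonalSystem S
  generating : ∀ X, extClosure S X

end Category

section Nakayama

variable {k A : Type u} [Field k] [Ring A] [Algebra k A]

/-- The underlying `k`-space of `ν M = D Hom_A(M, A)`, where `D` is the `k`-dual. -/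
def NakayamaSpace (M : StMod k A) : Type u := Module.Dual k (M →ₗ[A] A)

instance (M : StMod k A) : AddCommGroup (NakayamaSpace M) :=
  inferInstanceAs (AddCommGroup (Module.Dual k (M →ₗ[A] A)))

instance (M : StMod k A) : Module k (NakayamaSpace M) :=
  inferInstanceAs (Module k (Module.Dual k (M →ₗ[A] A)))

/-- For `a : A`, right multiplication by `a` on `Hom_A(M, A)`: `f ↦ (m ↦ f m * a)`. -/
def rightMul (M : StMod k A) (a : A) : (M →ₗ[A] A) →ₗ[k] (M →ₗ[A] A) where
  toFun f :=
    { toFun := fun m => f m * a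
      map_add' := fun x y => by rw [map_add, add_mul]
      map_smul' := fun b x => by simp [mul_assoc] }
  map_add' f g := by ext; simp [add_mul]
  map_smul' c f := by ext; simp

/-- The left `A`-module structure on `D Hom_A(M, A)`: `(a • φ) f = φ (f a)`. -/
instance (M : StMod k A) : Module A (NakayamaSpace M) where
  smul a φ := LinearMap.comp (show Module.Dual k (M →ₗ[A] A) from φ) (rightMul M a)
  one_smul φ := LinearMap.ext fun f =>
    congrArg (show Module.Dual k (M →ₗ[A] A) from φ) (LinearMap.ext fun m => mul_one (f m))
  mul_smul a b φ := LinearMap.ext fun f =>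
    congrArg (show Module.Dual k (M →ₗ[A] A) from φ)
      (LinearMap.ext fun m => (mul_assoc (f m) a b).symm)
  smul_zero _ := LinearMap.ext fun _ => rfl
  smul_add _ _ _ := LinearMap.ext fun _ => rfl
  add_smul a b φ := LinearMap.ext fun f =>
    (congrArg (show Module.Dual k (M →ₗ[A] A) from φ)
      (LinearMap.ext fun m => mul_add (f m) a b : rightMul M (a + b) f
        = rightMul M a f + rightMul M b f)).trans (map_add _ _ _)
  zero_smul φ := LinearMap.ext fun f =>
    (congrArg (show Module.Dual k (M →ₗ[A] A) from φ)
      (LinearMap.ext fun m => mul_zero (f m) : rightMul M 0 f = 0)).trans (map_zero _)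

instance (M : StMod k A) : IsScalarTower k A (NakayamaSpace M) where
  smul_assoc c a φ := LinearMap.ext fun f =>
    (congrArg (show Module.Dual k (M →ₗ[A] A) from φ)
      (LinearMap.ext fun m => mul_smul_comm c (f m) a : rightMul M (c • a) f
        = c • rightMul M a f)).trans (map_smul _ _ _)

instance [Module.Finite k A] (M : StMod k A) : Module.Finite k (M →ₗ[A] A) :=
  Module.Finite.of_injective
    ({ toFun := fun f => f.restrictScalars k
       map_add' := fun _ _ => rfl
       map_smul' := fun _ _ => rfl } : (M →ₗ[A] A) →ₗ[k] (M →ₗ[k] A))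
    (LinearMap.restrictScalars_injective k)

instance [Module.Finite k A] (M : StMod k A) : Module.Finite k (NakayamaSpace M) :=
  inferInstanceAs (Module.Finite k (Module.Dual k (M →ₗ[A] A)))

/-- The Nakayama functor `ν = D Hom_A(-, A)` on objects. -/
def nakayama [Module.Finite k A] (M : StMod k A) : StMod k A := ⟨NakayamaSpace M⟩

/-- `S` is Nakayama-stable: `ν` permutes the objects of `S` (objects of `A`-stmod being taken up
to isomorphism in `A`-stmod), that is, `ν(S) = S`. -/
structure IsNakayamaStable [Module.Finite k A] (S : ObjectProperty (StMod k A)) : Prop where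
  map_mem : ∀ M, S M → ∃ N, S N ∧ Nonempty (nakayama M ≅ N)
  surj : ∀ N, S N → ∃ M, S M ∧ Nonempty (nakayama M ≅ N)

end Nakayama

/-- `M` is an indecomposable `A`-module. -/
def IsIndecomposable {k A : Type u} [Field k] [Ring A] [Algebra k A] (M : StMod k A) : Prop :=
  Nontrivial M ∧ ∀ U V : Submodule A M, IsCompl U V → U = ⊥ ∨ V = ⊥

end StMod

/-- An RFS algebra, for a finite dimensional algebra `A` over an algebraically closed field `k`:
indecomposable, basic, representation-finite, self-injective, and not isomorphic to `k`. -/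
structure IsRFSAlgebra (k A : Type u) [Field k] [Ring A] [Algebra k A] : Prop where
  nontrivial : Nontrivial A
  /-- Indecomposable: the only central idempotents are `0` and `1`. -/
  indecomposable : ∀ e : A, IsIdempotentElem e → (∀ a, e * a = a * e) → e = 0 ∨ e = 1
  /-- Basic: modulo its radical, the algebra is a product of copies of `k`. -/
  basic : ∃ n : ℕ, Nonempty ((A ⧸ Ring.jacobson A) ≃ₐ[k] (Fin n → k))
  /-- Up to isomorphism there are only finitely many indecomposable modules. -/
  representationFinite : ∃ (n : ℕ) (X : Fin n → StMod k A), ∀ M : StMod k A,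
    M.IsIndecomposable → ∃ i, Nonempty (M ≃ₗ[A] X i)
  selfInjective : Module.Injective A A
  not_base : ¬ Nonempty (A ≃ₐ[k] k)

namespace StMod

variable {k A : Type u} [Field k] [Ring A] [Algebra k A]

/-! Fix `Z`. Among the maps `f : F ⟶ Z` with `F` in `F(S)` that are injective on stable morphisms
from objects of `S`, take one whose images in the spaces `X i ⟶ Z` have maximal total dimension,
where the finitely many `X i` represent all indecomposables. Make `f` the start of a short exact
sequence `F → Y → C` with `Y ≅ Z` stably. A nonzero stable map from some `M` in `S` to `C` would, by
pullback, give an extension of `M` by `F` with a strictly larger image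
(`exists_larger_approximation`); hence `Hom(S, C) = 0` (`exists_approximation`). It remains to show
`C = 0`. Auslander–Reiten duality (`toStable_eq_zero_of_comp_nakayama`) and `ν(S) = S` turn
injectivity of `Hom(S, F) → Hom(S, Y)` into injectivity of `Hom(C, S) → Hom(Y, S)`. If `Hom(Z, S) =
0`, then `C` is orthogonal to `S` on both sides, so `C = 0`; the identity of `Y` then factors
through `F`, although `Hom(Y, F) = 0`, and so `Z = 0`. Thus the left orthogonal of `S` vanishes. The
same duality shows that the cosyzygy of an object of the right orthogonal lies in the left one, so
the right orthogonal vanishes too, and `C = 0` for every `Z`. -/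

instance finite_hom (M N : StMod k A) : Module.Finite k (M →ₗ[A] N) :=
  Module.Finite.of_injective
    ({ toFun := fun f => f.restrictScalars k
       map_add' := fun _ _ => rfl
       map_smul' := fun _ _ => rfl } : (M →ₗ[A] N) →ₗ[k] (M →ₗ[k] N))
    (LinearMap.restrictScalars_injective k)

instance finite_submodule (M : StMod k A) (U : Submodule A M) : Module.Finite k U :=
  Module.Finite.of_injective (U.subtype.restrictScalars k) U.subtype_injective

instance finite_quotient (M : StMod k A) (U : Submodule A M) : Module.Finite k (M ⧸ U) :=
  Module.Finite.of_surjective (U.mkQ.restrictScalars k) U.mkQ_surjective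

/-- A submodule of a finite dimensional module. -/
abbrev sub (M : StMod k A) (U : Submodule A M) : StMod k A := ⟨U⟩

/-- A quotient of a finite dimensional module. -/
abbrev quot (M : StMod k A) (U : Submodule A M) : StMod k A := ⟨M ⧸ U⟩

/-- The free module of rank `n`. -/
abbrev free (k A : Type u) [Field k] [Ring A] [Algebra k A] [Module.Finite k A] (n : ℕ) :
    StMod k A := ⟨Fin n → A⟩

/-! ### Embedding finite dimensional modules into free modules -/

lemma finrank_sub_add_quot (M : StMod k A) (U : Submodule A M) :
    Module.finrank k (M.sub U) + Module.finrank k (M.quot U) = Module.finrank k M := by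
  have h := LinearMap.finrank_range_add_finrank_ker (U.mkQ.restrictScalars k)
  rw [LinearMap.range_eq_top.2 (show Function.Surjective (U.mkQ.restrictScalars k) from
    U.mkQ_surjective), finrank_top] at h
  have h2 : Module.finrank k (LinearMap.ker (U.mkQ.restrictScalars k)) = Module.finrank k U := by
    refine LinearEquiv.finrank_eq (LinearEquiv.ofEq _ (U.restrictScalars k) ?_)
    ext x
    simp
  rw [h2] at h
  change Module.finrank k U + Module.finrank k (M ⧸ U) = _
  omega

lemma finrank_dual_le_sub_add_quot [Module.Finite k A] (M : StMod k A) (U : Submodule A M) :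
    Module.finrank k (M →ₗ[A] A) ≤
      Module.finrank k (M.sub U →ₗ[A] A) + Module.finrank k (M.quot U →ₗ[A] A) := by
  let r : (M →ₗ[A] A) →ₗ[k] (U →ₗ[A] A) := LinearMap.lcomp k A U.subtype
  let q : (M ⧸ U →ₗ[A] A) →ₗ[k] (M →ₗ[A] A) := LinearMap.lcomp k A U.mkQ
  have hker : LinearMap.ker r ≤ LinearMap.range q := by
    intro f hf
    have hU : U ≤ LinearMap.ker f := fun x hx => LinearMap.congr_fun hf ⟨x, hx⟩
    exact ⟨U.liftQ f hU, U.liftQ_mkQ f hU⟩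
  have : Module.Finite k (U →ₗ[A] A) := inferInstanceAs (Module.Finite k (M.sub U →ₗ[A] A))
  have : Module.Finite k (M ⧸ U →ₗ[A] A) := inferInstanceAs (Module.Finite k (M.quot U →ₗ[A] A))
  have h1 := LinearMap.finrank_range_add_finrank_ker r
  have h2 := Submodule.finrank_mono hker
  have h3 := LinearMap.finrank_range_le q
  have h4 := Submodule.finrank_le (LinearMap.range r)
  change _ ≤ Module.finrank k (U →ₗ[A] A) + Module.finrank k (M ⧸ U →ₗ[A] A)
  omega

lemma isUnit_one_sub_of_mem_jacobson [IsNoetherianRing A] {x : A} (hx : x ∈ Ring.jacobson A) :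
    IsUnit (1 - x) := by
  rw [← Ideal.jacobson_bot, Ideal.mem_jacobson_iff] at hx
  obtain ⟨z, hz⟩ := hx (-1)
  have h : z * (1 - x) = 1 := by
    rw [Ideal.mem_bot] at hz
    rw [← sub_eq_zero, ← hz]
    noncomm_ring
  exact isUnit_iff_exists.2 ⟨z, mul_eq_one_symm h, h⟩

/-- Self-injectivity makes any nonzero element generate `Hom_A(M, A)` as a right `A`-module. The
radical then acts by zero, so the action is commutative, and an eigenvector argument over the
algebraically closed field leaves dimension at most one. -/
lemma finrank_dual_le_one_of_isSimple [Module.Finite k A] [IsAlgClosed k] (hinj : Module.Injective A A)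
    (hcomm : ∀ a b : A, a * b - b * a ∈ Ring.jacobson A) (M : StMod k A) [IsSimpleModule A M] :
    Module.finrank k (M →ₗ[A] A) ≤ 1 := by
  have hN : IsNoetherianRing A := isNoetherian_of_tower k inferInstance
  rcases subsingleton_or_nontrivial (M →ₗ[A] A) with h | h
  · rw [Module.finrank_zero_of_subsingleton]; exact zero_le_one
  have gen : ∀ v w : M →ₗ[A] A, v ≠ 0 → ∃ b, rightMul M b v = w := by
    intro v w hv
    obtain ⟨h, hh⟩ := hinj.out v (LinearMap.injective_of_ne_zero hv) w
    refine ⟨h 1, LinearMap.ext fun m => ?_⟩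
    rw [← hh m]
    change v m * h 1 = h (v m)
    rw [← smul_eq_mul, ← map_smul, smul_eq_mul, mul_one]
  have rad : ∀ (v : M →ₗ[A] A), ∀ j ∈ Ring.jacobson A, rightMul M j v = 0 := by
    intro v j hj
    by_contra hv
    obtain ⟨b, hb⟩ := gen _ v hv
    have hu := isUnit_one_sub_of_mem_jacobson (Ideal.IsTwoSided.mul_mem_of_left b hj)
    refine hv ?_
    have hv0 : v = 0 := by
      ext m
      have h1 : v m * (1 - j * b) = 0 := by
        rw [mul_sub, mul_one, ← mul_assoc, sub_eq_zero]
        exact (LinearMap.congr_fun hb m).symm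
      simpa using (hu.mul_left_eq_zero).1 h1
    rw [hv0, map_zero]
  obtain ⟨v₀, hv₀⟩ := exists_ne (0 : M →ₗ[A] A)
  refine finrank_le_one v₀ fun w => ?_
  obtain ⟨c, rfl⟩ := gen v₀ w hv₀
  obtain ⟨μ, hμ⟩ := Module.End.exists_eigenvalue (rightMul M c)
  obtain ⟨v, hv, hv0⟩ := hμ.exists_hasEigenvector
  rw [Module.End.mem_eigenspace_iff] at hv
  -- Since `v₀ = v b` and `b`, `c` act commutatively, `v₀` is an eigenvector of `c` for the same `μ`
  -- as `v`.
  obtain ⟨b, rfl⟩ := gen v v₀ hv0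
  refine ⟨μ, ?_⟩
  rw [← map_smul, ← hv, ← sub_eq_zero]
  have := rad v _ (hcomm c b)
  rw [← this]
  ext m
  change v m * c * b - v m * b * c = v m * (c * b - b * c)
  noncomm_ring

lemma finrank_dual_le [Module.Finite k A] [IsAlgClosed k] (hinj : Module.Injective A A)
    (hcomm : ∀ a b : A, a * b - b * a ∈ Ring.jacobson A) (M : StMod k A) :
    Module.finrank k (M →ₗ[A] A) ≤ Module.finrank k M := by
  induction hn : Module.finrank k M using Nat.strong_induction_on generalizing M with
  | _ n ih =>
    subst hn
    rcases subsingleton_or_nontrivial M with h | h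
    · rw [Module.finrank_zero_of_subsingleton]; exact zero_le
    by_cases hs : IsSimpleModule A M
    · exact (finrank_dual_le_one_of_isSimple hinj hcomm M).trans Module.finrank_pos
    · have : ∃ U : Submodule A M, U ≠ ⊥ ∧ U ≠ ⊤ := by
        by_contra! hU
        exact hs { eq_bot_or_eq_top := fun U => or_iff_not_imp_left.2 (hU U) }
      obtain ⟨U, hb, ht⟩ := this
      have := Submodule.nontrivial_iff_ne_bot.2 hb
      have := Submodule.Quotient.nontrivial_iff.2 ht
      have h0 := M.finrank_sub_add_quot U
      have h1 : 0 < Module.finrank k (M.sub U) := Module.finrank_pos (R := k) (M := U)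
      have h2 : 0 < Module.finrank k (M.quot U) := Module.finrank_pos (R := k) (M := M ⧸ U)
      have h3 := M.finrank_dual_le_sub_add_quot U
      have h4 := ih _ (by omega) (M.sub U) rfl
      have h5 := ih _ (by omega) (M.quot U) rfl
      omega

/-- A dimension count: the cyclic module `Am` is `A ⧸ L`, and `dim Hom(L, A) ≤ dim L` forces `dim
Hom(A ⧸ L, A) ≥ dim (A ⧸ L) > 0`. A nonzero map on `Am` does not kill the generator and extends to
`M` by injectivity of `A`. -/
lemma exists_dual_apply_ne_zero [Module.Finite k A] [IsAlgClosed k] (hinj : Module.Injective A A)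
    (hcomm : ∀ a b : A, a * b - b * a ∈ Ring.jacobson A) (M : StMod k A) {m : M} (hm : m ≠ 0) :
    ∃ f : M →ₗ[A] A, f m ≠ 0 := by
  let R : StMod k A := ⟨A⟩
  let t : R →ₗ[A] M := LinearMap.toSpanSingleton A M m
  let L : Submodule A R := LinearMap.ker t
  have h1 : Module.finrank k (R →ₗ[A] A) = Module.finrank k R :=
    LinearEquiv.finrank_eq (LinearMap.ringLmapEquivSelf A k A)
  have h2 := R.finrank_dual_le_sub_add_quot L
  have h3 := R.finrank_sub_add_quot L
  have h4 := finrank_dual_le hinj hcomm (R.sub L)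
  have : Nontrivial (R.quot L) := Submodule.Quotient.nontrivial_iff.2 fun h => hm <| by
    have : (1 : A) ∈ L := h ▸ Submodule.mem_top
    simpa [L, t] using this
  have h5 : 0 < Module.finrank k (R.quot L) := Module.finrank_pos
  have : Nontrivial (R.quot L →ₗ[A] A) :=
    Module.nontrivial_of_finrank_pos (R := k) (by omega)
  obtain ⟨f₀, hf₀⟩ := exists_ne (0 : R.quot L →ₗ[A] A)
  obtain ⟨f, hf⟩ := hinj.out (L.liftQ t le_rfl)
    (LinearMap.ker_eq_bot.1 (Submodule.ker_liftQ_eq_bot' _ _ rfl)) f₀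
  refine ⟨f, fun h => hf₀ ?_⟩
  have h6 : f₀ (L.mkQ (1 : A)) = 0 := by
    rw [← hf]
    change f ((1 : A) • m) = 0
    rw [one_smul, h]
  refine Submodule.linearMap_qext _ (LinearMap.ext_ring ?_)
  simpa using h6

/-- Over a self-injective algebra that is commutative modulo its radical, every finite dimensional
module embeds in a free module. -/
lemma exists_injective_to_free [Module.Finite k A] [IsAlgClosed k] (hinj : Module.Injective A A)
    (hcomm : ∀ a b : A, a * b - b * a ∈ Ring.jacobson A) (M : StMod k A) :
    ∃ (n : ℕ) (ι : M →ₗ[A] free k A n), Function.Injective ι := by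
  let b := Module.finBasis k (M →ₗ[A] A)
  refine ⟨_, LinearMap.pi fun i => b i, ?_⟩
  refine (injective_iff_map_eq_zero _).2 fun m hm => ?_
  by_contra hm0
  obtain ⟨f, hf⟩ := exists_dual_apply_ne_zero hinj hcomm M hm0
  refine hf ?_
  let ev : (M →ₗ[A] A) →ₗ[k] A :=
    { toFun := fun f => f m, map_add' := fun _ _ => rfl, map_smul' := fun _ _ => rfl }
  have : ev = 0 := b.ext fun i => congrFun hm i
  exact LinearMap.congr_fun this f

/-- Finite dimensional projectives over a self-injective algebra are injective. -/
lemma exists_extension_of_projective (hinj : Module.Injective A A) {X Y P : StMod k A}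
    [hP : Module.Projective A P] (i : X →ₗ[A] Y) (hi : Function.Injective i) (a : X →ₗ[A] P) :
    ∃ a' : Y →ₗ[A] P, a' ∘ₗ i = a := by
  have : Module.Finite A P := Module.Finite.of_restrictScalars_finite k A P
  obtain ⟨n, p, hp⟩ := Module.Finite.exists_fin' A P
  obtain ⟨s, hs⟩ := Module.projective_lifting_property p LinearMap.id hp
  obtain ⟨h, hh⟩ := (inferInstance : Module.Injective A (Fin n → A)).out i hi (s ∘ₗ a)
  refine ⟨p ∘ₗ h, LinearMap.ext fun x => ?_⟩
  simpa [hh] using LinearMap.congr_fun hs (a x)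

/-! ### Stable morphisms and short exact sequences -/

lemma toStable_surjective {M N : StMod k A} (f : M ⟶ N) : ∃ g : M →ₗ[A] N, toStable g = f :=
  Submodule.mkQ_surjective _ f

lemma toStable_eq_zero_iff {M N : StMod k A} (f : M →ₗ[A] N) :
    toStable f = 0 ↔ f ∈ projHom M N :=
  Submodule.Quotient.mk_eq_zero _

lemma toStable_comp {L M N : StMod k A} (f : L →ₗ[A] M) (g : M →ₗ[A] N) :
    toStable (g ∘ₗ f) = toStable f ≫ toStable g := rfl

lemma toStable_id (M : StMod k A) : toStable (LinearMap.id : M →ₗ[A] M) = 𝟙 M := rfl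

lemma toStable_sub {M N : StMod k A} (f g : M →ₗ[A] N) :
    toStable (f - g) = toStable f - toStable g :=
  map_sub (projHom M N).mkQ f g

lemma toStable_add {M N : StMod k A} (f g : M →ₗ[A] N) :
    toStable (f + g) = toStable f + toStable g :=
  map_add (projHom M N).mkQ f g

lemma toStable_eq_iff {M N : StMod k A} (f g : M →ₗ[A] N) :
    toStable f = toStable g ↔ f - g ∈ projHom M N := by
  rw [← toStable_eq_zero_iff, toStable_sub, sub_eq_zero]

lemma isZero_iff_projective (M : StMod k A) : IsZero M ↔ Module.Projective A M := by
  rw [IsZero.iff_id_eq_zero, ← toStable_id, toStable_eq_zero_iff]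
  constructor
  · rintro ⟨P, g, h, hP, e⟩
    exact Module.Projective.of_split g h e.symm
  · intro h
    exact ⟨M, LinearMap.id, LinearMap.id, h, rfl⟩

section Exact

variable {X Y Z : StMod k A} {i : X →ₗ[A] Y} {p : Y →ₗ[A] Z}

lemma exists_comp_eq_of_exact (hi : Function.Injective i) (hip : Function.Exact i p)
    {W : StMod k A} {f : W →ₗ[A] Y} (hf : p ∘ₗ f = 0) : ∃ t : W →ₗ[A] X, i ∘ₗ t = f := by
  choose t ht using fun w => (hip (f w)).1 (LinearMap.congr_fun hf w)
  refine ⟨⟨⟨t, fun x y => hi ?_⟩, fun a x => hi ?_⟩, LinearMap.ext ht⟩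
  · simp [ht]
  · simp [ht]

lemma exists_eq_comp_of_exact (hp : Function.Surjective p) (hip : Function.Exact i p)
    {W : StMod k A} {f : Y →ₗ[A] W} (hf : f ∘ₗ i = 0) : ∃ t : Z →ₗ[A] W, t ∘ₗ p = f := by
  have hk : LinearMap.ker p ≤ LinearMap.ker f := by
    intro y hy
    obtain ⟨x, rfl⟩ := (hip y).1 hy
    exact LinearMap.congr_fun hf x
  refine ⟨(LinearMap.ker p).liftQ f hk ∘ₗ (p.quotKerEquivOfSurjective hp).symm.toLinearMap, ?_⟩
  ext y
  have : (p.quotKerEquivOfSurjective hp).symm (p y) = (LinearMap.ker p).mkQ y := by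
    rw [LinearEquiv.symm_apply_eq]
    rfl
  simp [this]

/-- Exactness of the covariant stable Hom functor on a short exact sequence. -/
lemma exists_toStable_comp_eq (hi : Function.Injective i) (hip : Function.Exact i p)
    (hp : Function.Surjective p) {W : StMod k A} {t : W →ₗ[A] Y}
    (ht : toStable (p ∘ₗ t) = 0) : ∃ t' : W →ₗ[A] X, toStable (i ∘ₗ t') = toStable t := by
  obtain ⟨P, a, b, hP, e⟩ := (toStable_eq_zero_iff _).1 ht
  obtain ⟨b', rfl⟩ := Module.projective_lifting_property p b hp
  obtain ⟨t', ht'⟩ := exists_comp_eq_of_exact hi hip (f := t - b' ∘ₗ a) (by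
    rw [LinearMap.comp_sub, e, LinearMap.comp_assoc, sub_self])
  refine ⟨t', ((toStable_eq_iff _ _).2 ⟨P, a, b', hP, ?_⟩).symm⟩
  rw [ht', sub_sub_cancel]

/-- Exactness of the contravariant stable Hom functor on a short exact sequence. -/
lemma exists_toStable_eq_comp (hinj : Module.Injective A A) (hi : Function.Injective i)
    (hip : Function.Exact i p) (hp : Function.Surjective p) {W : StMod k A} {φ : Y →ₗ[A] W}
    (hφ : toStable (φ ∘ₗ i) = 0) : ∃ φ' : Z →ₗ[A] W, toStable (φ' ∘ₗ p) = toStable φ := by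
  obtain ⟨P, a, b, hP, e⟩ := (toStable_eq_zero_iff _).1 hφ
  obtain ⟨a', rfl⟩ := exists_extension_of_projective hinj i hi a
  obtain ⟨φ', h⟩ := exists_eq_comp_of_exact hp hip (f := φ - b ∘ₗ a') (by
    rw [LinearMap.sub_comp, e, LinearMap.comp_assoc, sub_self])
  refine ⟨φ', ((toStable_eq_iff _ _).2 ⟨P, a', b, hP, ?_⟩).symm⟩
  rw [h, sub_sub_cancel]

end Exact

/-! ### Auslander–Reiten duality through `Hom_A(M, A) ⊗ₖ N` -/

section Duality

open TensorProduct

/-- The map `Hom_A(M, A) ⊗ₖ N → Hom_A(M, N)` sending `f ⊗ n` to `m ↦ f m • n`. -/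
noncomputable def dualTensorHom (M N : StMod k A) : (M →ₗ[A] A) ⊗[k] N →ₗ[k] (M →ₗ[A] N) :=
  TensorProduct.lift (LinearMap.mk₂ k (fun f n => f.smulRight n)
    (fun f g n => by ext; simp [add_smul]) (fun c f n => by ext; simp)
    (fun f n n' => by ext; simp) (fun c f n => LinearMap.ext fun m => smul_comm (f m) c n))

@[simp]
lemma dualTensorHom_tmul {M N : StMod k A} (f : M →ₗ[A] A) (n : N) :
    dualTensorHom M N (f ⊗ₜ n) = f.smulRight n := rfl

lemma dualTensorHom_lTensor {M N N' : StMod k A} (g : N →ₗ[A] N') (t : (M →ₗ[A] A) ⊗[k] N) :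
    dualTensorHom M N' ((g.restrictScalars k).lTensor _ t) = g ∘ₗ dualTensorHom M N t := by
  induction t with
  | zero => simp
  | add x y hx hy => rw [map_add, map_add, hx, hy, map_add, LinearMap.comp_add]
  | tmul f n => ext; simp

/-- Expand in a finite dual basis of the projective. With `dualTensorHom_mem_projHom`, this
identifies the image of `dualTensorHom` with `projHom`. -/
lemma exists_dualTensorHom_eq {M N : StMod k A} {h : M →ₗ[A] N} (hh : h ∈ projHom M N) :
    ∃ t, dualTensorHom M N t = h := by
  obtain ⟨P, a, b, hP, rfl⟩ := hh
  have : Module.Finite A P := Module.Finite.of_restrictScalars_finite k A P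
  obtain ⟨n, p, hp⟩ := Module.Finite.exists_fin' A P
  obtain ⟨s, hs⟩ := Module.projective_lifting_property p LinearMap.id hp
  refine ⟨∑ l, (LinearMap.proj l ∘ₗ s ∘ₗ a) ⊗ₜ b (p (Pi.single l 1)), LinearMap.ext fun m => ?_⟩
  have h1 : p (s (a m)) = a m := LinearMap.congr_fun hs (a m)
  have h2 : (b ∘ₗ a) m = b (p (∑ l, s (a m) l • Pi.single l 1)) := by
    rw [← pi_eq_sum_univ', h1]; rfl
  rw [h2]
  simp

variable [Module.Finite k A]

lemma dualTensorHom_mem_projHom {M N : StMod k A} (t : (M →ₗ[A] A) ⊗[k] N) :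
    dualTensorHom M N t ∈ projHom M N := by
  induction t with
  | zero => rw [map_zero]; exact zero_mem _
  | add x y hx hy => rw [map_add]; exact add_mem hx hy
  | tmul f n =>
    exact ⟨⟨A⟩, f, LinearMap.toSpanSingleton A N n,
      inferInstanceAs (Module.Projective A A), rfl⟩

/-- The identification of `ν M` with the dual space of `Hom_A(M, A)`. -/
noncomputable def nakayamaEquiv (M : StMod k A) :
    nakayama M ≃ₗ[k] Module.Dual k (M →ₗ[A] A) :=
  LinearEquiv.refl k (Module.Dual k (M →ₗ[A] A))

@[simp]
lemma nakayamaEquiv_smul {M : StMod k A} (a : A) (φ : nakayama M) (f : M →ₗ[A] A) :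
    nakayamaEquiv M (a • φ) f = nakayamaEquiv M φ (rightMul M a f) := rfl

lemma exists_comp_eq_of_ker_le {V W : Type*} [AddCommGroup V] [Module k V] [AddCommGroup W]
    [Module k W] (e : V →ₗ[k] W) (φ : V →ₗ[k] k) (h : ∀ v, e v = 0 → φ v = 0) :
    ∃ c : W →ₗ[k] k, c ∘ₗ e = φ := by
  have hmem : φ ∈ LinearMap.range e.dualMap := by
    rw [LinearMap.range_dualMap_eq_dualAnnihilator_ker, Submodule.mem_dualAnnihilator]
    exact h
  exact hmem

/-- The functional on `Hom_A(M, A) ⊗ₖ N` corresponding to a map `N → D Hom_A(M, A)`. -/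
noncomputable def nakayamaPairing {M N : StMod k A} (ψ : N →ₗ[A] nakayama M) :
    (M →ₗ[A] A) ⊗[k] N →ₗ[k] k :=
  TensorProduct.lift ((nakayamaEquiv M).toLinearMap ∘ₗ ψ.restrictScalars k).flip

@[simp]
lemma nakayamaPairing_tmul {M N : StMod k A} (ψ : N →ₗ[A] nakayama M) (f : M →ₗ[A] A) (n : N) :
    nakayamaPairing ψ (f ⊗ₜ n) = nakayamaEquiv M (ψ n) f := rfl

lemma nakayamaPairing_comp {M N N' : StMod k A} (g : N →ₗ[A] N') (ψ : N' →ₗ[A] nakayama M)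
    (t : (M →ₗ[A] A) ⊗[k] N) :
    nakayamaPairing (ψ ∘ₗ g) t = nakayamaPairing ψ ((g.restrictScalars k).lTensor _ t) := by
  induction t with
  | zero => simp
  | add x y hx hy => rw [map_add, map_add, hx, hy, map_add]
  | tmul f n => rfl

/-- One half of the criterion that `ψ : N → ν M` is stably zero exactly when its pairing vanishes on
the kernel of `dualTensorHom M N`; naturality reduces it to the projective `P`. -/
lemma nakayamaPairing_eq_zero_of_mem_projHom {M N : StMod k A} {ψ : N →ₗ[A] nakayama M}
    (hψ : ψ ∈ projHom N (nakayama M)) {t : (M →ₗ[A] A) ⊗[k] N} (ht : dualTensorHom M N t = 0) :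
    nakayamaPairing ψ t = 0 := by
  obtain ⟨P, a, b, hP, rfl⟩ := hψ
  rw [nakayamaPairing_comp]
  have h0 : dualTensorHom M P ((a.restrictScalars k).lTensor _ t) = 0 := by
    rw [dualTensorHom_lTensor, ht, LinearMap.comp_zero]
  generalize (a.restrictScalars k).lTensor _ t = t' at h0
  have : Module.Finite A P := Module.Finite.of_restrictScalars_finite k A P
  obtain ⟨n, p, hp⟩ := Module.Finite.exists_fin' A P
  obtain ⟨s, hs⟩ := Module.projective_lifting_property p LinearMap.id hp
  let c : (M →ₗ[A] P) →ₗ[k] k := ∑ l, nakayamaEquiv M (b (p (Pi.single l 1))) ∘ₗ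
      LinearMap.compRight k (LinearMap.proj l ∘ₗ s)
  -- For projective `P` the pairing depends only on the induced map `M → P`; `c` is read off from
  -- the dual basis `x = ∑ (s x l) • p e_l`.
  suffices h : nakayamaPairing b = c ∘ₗ dualTensorHom M P by
    rw [h, LinearMap.comp_apply, h0, map_zero]
  refine TensorProduct.ext' fun f x => ?_
  have h1 : b x = ∑ l, s x l • b (p (Pi.single l 1)) := by
    have h2 : p (s x) = x := LinearMap.congr_fun hs x
    conv_lhs => rw [← h2, pi_eq_sum_univ' (s x)]
    simp
  rw [nakayamaPairing_tmul, h1, map_sum, LinearMap.comp_apply, dualTensorHom_tmul,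
    LinearMap.sum_apply, LinearMap.sum_apply]
  refine Finset.sum_congr rfl fun l _ => ?_
  rw [nakayamaEquiv_smul, LinearMap.comp_apply]
  refine congrArg (nakayamaEquiv M (b (p (Pi.single l 1)))) ?_
  ext m
  simp [rightMul]

/-- The converse half. The pairing extends to a functional `c` on `Hom_A(M, A^n)`; its `n`
components are elements of `ν M`, hence define a map `A^n → ν M` through which `ψ` factors. -/
lemma mem_projHom_of_nakayamaPairing {M N : StMod k A} {n : ℕ} {ι : N →ₗ[A] free k A n}
    (hι : Function.Injective ι) {ψ : N →ₗ[A] nakayama M}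
    (hψ : ∀ t, dualTensorHom M N t = 0 → nakayamaPairing ψ t = 0) :
    ψ ∈ projHom N (nakayama M) := by
  have hker : ∀ t, (LinearMap.compRight k ι ∘ₗ dualTensorHom M N) t = 0 →
      nakayamaPairing ψ t = 0 := fun t ht => by
    refine hψ t (LinearMap.ext fun m => hι ?_)
    rw [LinearMap.zero_apply, map_zero]
    exact LinearMap.congr_fun ht m
  obtain ⟨c, hc⟩ := exists_comp_eq_of_ker_le (V := (M →ₗ[A] A) ⊗[k] N)
    (W := M →ₗ[A] free k A n) (LinearMap.compRight k ι ∘ₗ dualTensorHom M N)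
    (nakayamaPairing ψ) hker
  let w : Fin n → nakayama M := fun l => (nakayamaEquiv M).symm
    (c ∘ₗ LinearMap.compRight k (LinearMap.single A (fun _ => A) l))
  refine ⟨free k A n, ι, Fintype.linearCombination A w,
    inferInstanceAs (Module.Projective A (Fin n → A)), ?_⟩
  refine LinearMap.ext fun x => (nakayamaEquiv M).injective (LinearMap.ext fun f => ?_)
  have h2 : ι ∘ₗ f.smulRight x =
      ∑ l, LinearMap.single A (fun _ => A) l ∘ₗ rightMul M (ι x l) f := by
    ext m l
    simp [rightMul, Pi.single_apply]
  rw [← nakayamaPairing_tmul, ← hc]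
  change c (ι ∘ₗ f.smulRight x) = nakayamaEquiv M (∑ l, ι x l • w l) f
  rw [h2, map_sum, map_sum, LinearMap.sum_apply]
  refine Finset.sum_congr rfl fun l _ => ?_
  rw [nakayamaEquiv_smul, LinearEquiv.apply_symm_apply]
  rfl

/-- Auslander–Reiten duality in the form used here: if `0 → X → Y → Z → 0` is exact and
`Hom(M, X) → Hom(M, Y)` is injective in the stable category, so is
`Hom(Z, ν M) → Hom(Y, ν M)`. -/
lemma toStable_eq_zero_of_comp_nakayama {X Y Z M : StMod k A} {i : X →ₗ[A] Y} {p : Y →ₗ[A] Z}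
    (hi : Function.Injective i) (hip : Function.Exact i p) (hp : Function.Surjective p)
    {n : ℕ} {ι : Z →ₗ[A] free k A n} (hι : Function.Injective ι)
    (hM : ∀ h : M →ₗ[A] X, toStable (i ∘ₗ h) = 0 → toStable h = 0)
    {ψ : Z →ₗ[A] nakayama M} (hψ : toStable (ψ ∘ₗ p) = 0) : toStable ψ = 0 := by
  rw [toStable_eq_zero_iff] at hψ ⊢
  refine mem_projHom_of_nakayamaPairing hι fun t ht => ?_
  -- A snake-type chase: lift `t` to `Y`; its image in `Hom(M, Y)` comes from some `h : M → X`,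
  -- which is stably zero by `hM`, so `t` can be corrected by a tensor over `X` to lie in the kernel
  -- over `Y`. The correction dies in `Z`.
  obtain ⟨t, rfl⟩ := LinearMap.lTensor_surjective (M →ₗ[A] A) (g := p.restrictScalars k) hp t
  rw [dualTensorHom_lTensor] at ht
  obtain ⟨h, hh⟩ := exists_comp_eq_of_exact hi hip ht
  have hproj : toStable (i ∘ₗ h) = 0 := by
    rw [hh, toStable_eq_zero_iff]
    exact dualTensorHom_mem_projHom t
  obtain ⟨v, hv⟩ := exists_dualTensorHom_eq ((toStable_eq_zero_iff _).1 (hM h hproj))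
  have h1 : dualTensorHom M Y (t - (i.restrictScalars k).lTensor _ v) = 0 := by
    rw [map_sub, dualTensorHom_lTensor, hv, hh, sub_self]
  have h2 := nakayamaPairing_eq_zero_of_mem_projHom hψ h1
  rw [map_sub, nakayamaPairing_comp, nakayamaPairing_comp, sub_eq_zero] at h2
  rw [h2, ← LinearMap.lTensor_comp_apply]
  have h3 : p.restrictScalars k ∘ₗ i.restrictScalars k = 0 := LinearMap.ext hip.apply_apply_eq_zero
  rw [h3, LinearMap.lTensor_zero, LinearMap.zero_apply, map_zero]

end Duality

/-! ### Exactness of stable Hom on triangles -/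

section Triangle

variable {X Y Z : StMod k A} {f : X ⟶ Y} {g : Y ⟶ Z}

lemma IsTrianglePair.exists_comp_eq (h : IsTrianglePair f g) {W : StMod k A} (t : W ⟶ Y)
    (ht : t ≫ g = 0) : ∃ t' : W ⟶ X, t' ≫ f = t := by
  obtain ⟨X', Y', Z', i, p, hi, hip, hp, a, b, c, hf, hg⟩ := h
  obtain ⟨τ, hτ⟩ := toStable_surjective (t ≫ b.hom)
  obtain ⟨τ', hτ'⟩ := exists_toStable_comp_eq hi hip hp (t := τ) (by
    rw [toStable_comp, hτ, Category.assoc, ← hg, reassoc_of% ht, zero_comp])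
  refine ⟨toStable τ' ≫ a.inv, ?_⟩
  rw [← cancel_mono b.hom, Category.assoc, Category.assoc, hf, a.inv_hom_id_assoc, ← hτ, ← hτ',
    toStable_comp]

lemma IsTrianglePair.exists_eq_comp (hinj : Module.Injective A A) (h : IsTrianglePair f g)
    {W : StMod k A} (t : Y ⟶ W) (ht : f ≫ t = 0) : ∃ t' : Z ⟶ W, g ≫ t' = t := by
  obtain ⟨X', Y', Z', i, p, hi, hip, hp, a, b, c, hf, hg⟩ := h
  obtain ⟨τ, hτ⟩ := toStable_surjective (b.inv ≫ t)
  have h0 : toStable i ≫ b.inv = a.inv ≫ f := by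
    rw [Iso.comp_inv_eq, Category.assoc, hf, a.inv_hom_id_assoc]
  obtain ⟨τ', hτ'⟩ := exists_toStable_eq_comp hinj hi hip hp (φ := τ) (by
    rw [toStable_comp, hτ, reassoc_of% h0, ht, comp_zero])
  refine ⟨c.hom ≫ toStable τ', ?_⟩
  rw [reassoc_of% hg, ← toStable_comp, hτ', hτ, b.hom_inv_id_assoc]

lemma isTrianglePair_of_exact {X Y Z : StMod k A} {i : X →ₗ[A] Y} {p : Y →ₗ[A] Z}
    (hi : Function.Injective i) (hip : Function.Exact i p) (hp : Function.Surjective p) :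
    IsTrianglePair (toStable i) (toStable p) :=
  ⟨X, Y, Z, i, p, hi, hip, hp, Iso.refl _, Iso.refl _, Iso.refl _, by simp, by simp⟩

end Triangle

/-! ### Maps into and out of objects of `F(S)` -/

section ExtClosure

variable {S : ObjectProperty (StMod k A)}

lemma extClosure_of_exact {X Y Z : StMod k A} {i : X →ₗ[A] Y} {p : Y →ₗ[A] Z}
    (hi : Function.Injective i) (hip : Function.Exact i p) (hp : Function.Surjective p)
    (hX : extClosure S X) (hZ : S Z ∨ IsZero Z) : extClosure S Y := by
  obtain ⟨n, hn⟩ := hX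
  exact ⟨n + 1, X, Z, _, _, hn, hZ, isTrianglePair_of_exact hi hip hp⟩

/-- The triangle `X ⟶ Y ⟶ 0` gives this at the cost of one extra level. -/
lemma extClosure_of_iso {X Y : StMod k A} (e : X ≅ Y) (hX : extClosure S X) :
    extClosure S Y := by
  obtain ⟨n, hn⟩ := hX
  let O : StMod k A := ⟨PUnit⟩
  have hO : IsZero O := (isZero_iff_projective _).2
    (inferInstanceAs (Module.Projective A PUnit.{u + 1}))
  refine ⟨n + 1, X, O, e.hom, 0, hn, Or.inr hO, X, X, O, LinearMap.id, 0,
    Function.injective_id, ?_, fun _ => ⟨0, Subsingleton.elim _ _⟩, Iso.refl _, e.symm,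
    Iso.refl _, ?_, ?_⟩
  · exact fun x => ⟨fun _ => ⟨x, rfl⟩, fun _ => rfl⟩
  · simp [toStable_id]
  · exact hO.eq_of_tgt _ _

/-- A map from an object of `F(S)` is killed by a power of any endomorphism killing all maps from
objects of `S`. -/
lemma comp_pow_eq_zero_of_filtLevel (hinj : Module.Injective A A) {F : StMod k A} (u : End F)
    (hu : ∀ M, S M → ∀ φ : M ⟶ F, φ ≫ u = 0) (n : ℕ) :
    ∀ (N : StMod k A), filtLevel S n N → ∀ φ : N ⟶ F, φ ≫ (u ^ n : End F) = 0 := by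
  induction n with
  | zero =>
    intro N hN φ
    exact IsZero.eq_of_src hN _ _
  | succ n ih =>
    rintro N ⟨X, Z, f, g, hX, hZ, hT⟩ φ
    -- After `u ^ n` the map vanishes on `X`, so it factors through `Z`, where one more `u` kills
    -- it.
    obtain ⟨ψ, hψ⟩ := hT.exists_eq_comp hinj (φ ≫ (u ^ n : End F)) (by
      rw [← Category.assoc]
      exact ih X hX _)
    have hψu : ψ ≫ u = 0 := by
      rcases hZ with hZ | hZ
      · exact hu Z hZ ψ
      · exact hZ.eq_of_src _ _
    have : (u ^ (n + 1) : End F) = (u ^ n : End F) ≫ u := pow_succ' u n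
    rw [this, ← Category.assoc, ← hψ, Category.assoc, hψu, comp_zero]

/-- The difference `x - 𝟙 F` kills all maps from `S`, hence is nilpotent because `F` is in `F(S)`.
-/
lemma isIso_of_extClosure (hinj : Module.Injective A A) {F : StMod k A}
    (hF : extClosure S F) (x : F ⟶ F) (hx : ∀ M, S M → ∀ φ : M ⟶ F, φ ≫ x = φ) : IsIso x := by
  obtain ⟨n, hn⟩ := hF
  let u : End F := x - 𝟙 F
  have hnil : IsNilpotent u := by
    refine ⟨n, ?_⟩
    rw [← Category.id_comp (u ^ n : End F)]
    refine comp_pow_eq_zero_of_filtLevel hinj u (fun M hM φ => ?_) n F hn (𝟙 F)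
    change φ ≫ (x - 𝟙 F) = 0
    rw [Preadditive.comp_sub, hx M hM, Category.comp_id, sub_self]
  have hu : u + 1 = x := sub_add_cancel x (𝟙 F)
  exact (isUnit_iff_isIso x).1 (hu ▸ hnil.isUnit_add_one)

/-- Peel the top factor off the filtration of `N`: the map dies there, so it lifts to the previous
level. -/
lemma eq_zero_of_leftOrthogonal {Z N : StMod k A} (hZ : S.leftOrthogonal Z)
    (hN : extClosure S N) (φ : Z ⟶ N) : φ = 0 := by
  obtain ⟨n, hn⟩ := hN
  induction n generalizing N with
  | zero => exact IsZero.eq_of_tgt hn _ _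
  | succ n ih =>
    obtain ⟨X, W, f, g, hX, hW, hT⟩ := hn
    obtain ⟨ψ, rfl⟩ := hT.exists_comp_eq φ (by
      rcases hW with hW | hW
      · exact hZ _ hW
      · exact hW.eq_of_tgt _ _)
    rw [ih ψ hX, zero_comp]

end ExtClosure

/-! ### Enlarging an approximation -/

lemma exists_pullback {X Y Z W : StMod k A} {i : X →ₗ[A] Y} {p : Y →ₗ[A] Z}
    (hi : Function.Injective i) (hip : Function.Exact i p) (hp : Function.Surjective p)
    (s : W →ₗ[A] Z) :
    ∃ (E : StMod k A) (j : X →ₗ[A] E) (q : E →ₗ[A] W) (r : E →ₗ[A] Y),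
      Function.Injective j ∧ Function.Exact j q ∧ Function.Surjective q ∧
        r ∘ₗ j = i ∧ p ∘ₗ r = s ∘ₗ q := by
  let B : StMod k A := ⟨Y × W⟩
  let U : Submodule A B :=
    LinearMap.eqLocus (p ∘ₗ LinearMap.fst A Y W) (s ∘ₗ LinearMap.snd A Y W)
  refine ⟨B.sub U, (LinearMap.inl A Y W ∘ₗ i).codRestrict U fun x => ?_,
    LinearMap.snd A Y W ∘ₗ U.subtype, LinearMap.fst A Y W ∘ₗ U.subtype, ?_, ?_, ?_, ?_, ?_⟩
  · change p (i x) = s 0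
    rw [hip.apply_apply_eq_zero, map_zero]
  · intro x y h
    exact hi (congrArg (fun z : U => z.1.1) h)
  · rintro ⟨⟨y, w⟩, h⟩
    constructor
    · rintro (rfl : w = 0)
      have h' : p y = s 0 := h
      rw [map_zero] at h'
      obtain ⟨x, rfl⟩ := (hip y).1 h'
      exact ⟨x, rfl⟩
    · rintro ⟨x, hx⟩
      exact (congrArg (fun z : U => z.1.2) hx).symm
  · intro w
    obtain ⟨y, hy⟩ := hp (s w)
    exact ⟨⟨(y, w), hy⟩, rfl⟩
  · rfl
  · exact LinearMap.ext fun z => z.2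

lemma IsStableBrick.id_ne_zero {M : StMod k A} (h : IsStableBrick M) : 𝟙 M ≠ 0 := by
  obtain ⟨e⟩ := h
  intro h0
  have h1 : ∀ f : M ⟶ M, f = 0 := fun f => by rw [← Category.comp_id f, h0, comp_zero]
  have := e.symm.map_eq_zero_iff.1 (h1 (e.symm 1))
  exact one_ne_zero this

lemma IsStableBrick.exists_smul_id {M : StMod k A} (h : IsStableBrick M) (f : M ⟶ M) :
    ∃ c : k, f = c • 𝟙 M := by
  have h0 := h.id_ne_zero
  obtain ⟨e⟩ := h
  have h1 : e (𝟙 M) ≠ 0 := fun h => h0 (e.map_eq_zero_iff.1 h)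
  refine ⟨e f / e (𝟙 M), e.injective ?_⟩
  rw [map_smul, smul_eq_mul, div_mul_cancel₀ _ h1]

/-- `f` induces injections on the stable morphisms from objects of `S`. -/
def InjectiveOn (S : ObjectProperty (StMod k A)) {F Z : StMod k A} (f : F ⟶ Z) : Prop :=
  ∀ M, S M → ∀ φ : M ⟶ F, φ ≫ f = 0 → φ = 0

/-- If `F` in `F(S)` approximates `Y` with cokernel `Z`, then a nonzero map from an object of `S`
to `Z` yields a strictly larger approximation. -/
lemma exists_larger_approximation (hinj : Module.Injective A A)
    {S : ObjectProperty (StMod k A)} (hS : IsOrthogonalSystem S) {F Y Z M : StMod k A}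
    {i : F →ₗ[A] Y} {p : Y →ₗ[A] Z} (hi : Function.Injective i) (hip : Function.Exact i p)
    (hp : Function.Surjective p) (hF : extClosure S F) (hiS : InjectiveOn S (toStable i))
    (hM : S M) (s : M →ₗ[A] Z) (hs : toStable s ≠ 0) :
    ∃ (E : StMod k A) (j : F ⟶ E) (r : E ⟶ Y), extClosure S E ∧ InjectiveOn S r ∧
      j ≫ r = toStable i ∧ ¬ ∃ g : E ⟶ F, g ≫ toStable i = r := by
  obtain ⟨E, j, q, r, hj, hjq, hq, hrj, hpr⟩ := exists_pullback hi hip hp s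
  have hT := isTrianglePair_of_exact hj hjq hq
  have hrj' : toStable j ≫ toStable r = toStable i := by rw [← toStable_comp, hrj]
  have hpr' : toStable r ≫ toStable p = toStable q ≫ toStable s := by
    rw [← toStable_comp, hpr, toStable_comp]
  have hr : InjectiveOn S (toStable r) := by
    intro N hN t ht
    -- By orthogonality `t ≫ q` is zero or a scalar; a nonzero scalar is excluded because `t ≫ q ≫ s
    -- = t ≫ r ≫ p = 0` while `s ≠ 0`.
    have hqt : t ≫ toStable q = 0 := by
      by_cases hNM : N = M
      · subst hNM
        obtain ⟨c, hc⟩ := (hS.brick N hN).exists_smul_id (t ≫ toStable q)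
        have h1 : c • toStable s = 0 := by
          rw [← Category.id_comp (toStable s), ← Linear.smul_comp, ← hc, Category.assoc, ← hpr',
            reassoc_of% ht, zero_comp]
        rw [hc, (smul_eq_zero.1 h1).resolve_right hs, zero_smul]
      · exact hS.orthogonal N M hN hM hNM _
    obtain ⟨t', rfl⟩ := hT.exists_comp_eq t hqt
    rw [hiS N hN t' (by rw [← hrj', ← Category.assoc, ht]), zero_comp]
  refine ⟨E, toStable j, toStable r, extClosure_of_exact hj hjq hq hF (Or.inl hM), hr, hrj', ?_⟩
  rintro ⟨g, hg⟩
  -- If `r` factored through `i` by `g`, then `j ≫ g` would fix all maps from `S`, since they are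
  -- detected after composing with `i`.
  have hu : IsIso (toStable j ≫ g) := by
    refine isIso_of_extClosure hinj hF _ fun N hN φ => ?_
    rw [← sub_eq_zero]
    refine hiS N hN _ ?_
    have h1 : (toStable j ≫ g) ≫ toStable i = toStable i := by rw [Category.assoc, hg, hrj']
    rw [Preadditive.sub_comp, Category.assoc, h1, sub_self]
  obtain ⟨v, hv, -⟩ := hu
  have hv' : toStable j ≫ (g ≫ v) = 𝟙 F := by rw [← Category.assoc, hv]
  obtain ⟨ρ, hρ⟩ := toStable_surjective (g ≫ v)
  rw [← hρ, ← toStable_comp, ← toStable_id, toStable_eq_iff] at hv'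
  obtain ⟨P, a, b, hP, e⟩ := hv'
  -- Projectives are injective, so the stable retraction of `j` can be corrected to an honest one;
  -- the sequence splits and `q` has a section `t`.
  obtain ⟨a', rfl⟩ := exists_extension_of_projective hinj j hj a
  have hsplit : (ρ - b ∘ₗ a') ∘ₗ j = LinearMap.id := by
    rw [LinearMap.sub_comp, LinearMap.comp_assoc, ← e, sub_sub_cancel]
  obtain ⟨t, ht⟩ := exists_eq_comp_of_exact hq hjq (f := LinearMap.id - j ∘ₗ (ρ - b ∘ₗ a')) (by
    rw [LinearMap.sub_comp, LinearMap.comp_assoc, hsplit, LinearMap.id_comp,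
      LinearMap.comp_id, sub_self])
  have hqj : q ∘ₗ j = 0 := LinearMap.ext hjq.apply_apply_eq_zero
  have hqt : q ∘ₗ t = LinearMap.id := by
    refine LinearMap.cancel_right hq |>.1 ?_
    rw [LinearMap.comp_assoc, ht, LinearMap.comp_sub, ← LinearMap.comp_assoc, hqj]
    simp
  -- Both maps agree after `r`, which is injective on maps from `M`. Hence the section `t` factors
  -- through `j`, so `𝟙 M = t ≫ q = 0`, which is absurd for a brick.
  have h2 : toStable t - toStable t ≫ g ≫ toStable j = 0 := by
    refine hr M hM _ ?_
    rw [Preadditive.sub_comp, Category.assoc, Category.assoc, hrj', hg, sub_self]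
  refine (hS.brick M hM).id_ne_zero ?_
  rw [← toStable_id, ← hqt, toStable_comp, sub_eq_zero.1 h2, Category.assoc, Category.assoc,
    ← toStable_comp, hqj, (toStable_eq_zero_iff _).2 (zero_mem _), comp_zero, comp_zero]

/-! ### Maximal approximations from representation-finiteness -/

instance finite_stHom (M N : StMod k A) : Module.Finite k (M ⟶ N) :=
  inferInstanceAs (Module.Finite k ((M →ₗ[A] N) ⧸ projHom M N))

/-- A property that holds for indecomposable modules and is inherited by direct sums holds for all
finite dimensional modules. -/
lemma induction_on_indecomposable {P : StMod k A → Prop}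
    (zero : ∀ W : StMod k A, Subsingleton W → P W)
    (indecomposable : ∀ W : StMod k A, W.IsIndecomposable → P W)
    (sum : ∀ (W : StMod k A) (U V : Submodule A W), IsCompl U V → P (W.sub U) → P (W.sub V) → P W)
    (W : StMod k A) : P W := by
  induction hn : Module.finrank k W using Nat.strong_induction_on generalizing W with
  | _ n ih =>
    subst hn
    rcases subsingleton_or_nontrivial W with h | h
    · exact zero W h
    by_cases hW : W.IsIndecomposable
    · exact indecomposable W hW
    have hUV : ∃ U V : Submodule A W, IsCompl U V ∧ U ≠ ⊥ ∧ V ≠ ⊥ := by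
      by_contra! hUV
      exact hW ⟨h, fun U V hc => or_iff_not_imp_left.2 (hUV U V hc)⟩
    obtain ⟨U, V, hc, hU, hV⟩ := hUV
    have lt : ∀ U V : Submodule A W, IsCompl U V → V ≠ ⊥ →
        Module.finrank k (W.sub U) < Module.finrank k W := by
      intro U V hc hV
      have := Submodule.Quotient.nontrivial_iff.2
        (show U ≠ ⊤ from fun h => hV (by simpa [h] using hc.inf_eq_bot))
      have h1 : 0 < Module.finrank k (W.quot U) := Module.finrank_pos (R := k) (M := W ⧸ U)
      have := W.finrank_sub_add_quot U
      omega
    exact sum W U V hc (ih _ (lt U V hc hV) _ rfl) (ih _ (lt V U hc.symm hU) _ rfl)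

/-- If every map to `E` from one of the indecomposable modules `X i` factors through `f` after
composition with `g`, then so does every map. -/
lemma exists_comp_eq_of_indecomposables {n : ℕ} {X : Fin n → StMod k A}
    (hX : ∀ M : StMod k A, M.IsIndecomposable → ∃ i, Nonempty (M ≃ₗ[A] X i))
    {F E Z : StMod k A} {f : F ⟶ Z} {g : E ⟶ Z}
    (h : ∀ i, ∀ φ : X i ⟶ E, ∃ ψ : X i ⟶ F, ψ ≫ f = φ ≫ g) (W : StMod k A) :
    ∀ φ : W ⟶ E, ∃ ψ : W ⟶ F, ψ ≫ f = φ ≫ g := by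
  induction W using induction_on_indecomposable with
  | zero W hW =>
    intro φ
    have : IsZero W := (isZero_iff_projective W).2 inferInstance
    exact ⟨0, this.eq_of_src _ _⟩
  | indecomposable W hW =>
    intro φ
    obtain ⟨i, ⟨e⟩⟩ := hX W hW
    obtain ⟨ψ, hψ⟩ := h i (toStable e.symm.toLinearMap ≫ φ)
    refine ⟨toStable e.toLinearMap ≫ ψ, ?_⟩
    rw [Category.assoc, hψ, Category.assoc, ← Category.assoc, ← toStable_comp]
    simp [toStable_id]
  | sum W U V hc hU hV =>
    intro φ
    obtain ⟨ψ, hψ⟩ := hU (toStable U.subtype ≫ φ)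
    obtain ⟨ψ', hψ'⟩ := hV (toStable V.subtype ≫ φ)
    let πU : W →ₗ[A] W.sub U := U.projectionOnto V hc
    let πV : W →ₗ[A] W.sub V := V.projectionOnto U hc.symm
    refine ⟨toStable πU ≫ ψ + toStable πV ≫ ψ', ?_⟩
    have h1 : toStable πU ≫ toStable (M := W.sub U) U.subtype +
        toStable πV ≫ toStable (M := W.sub V) V.subtype = 𝟙 W := by
      rw [← toStable_comp, ← toStable_comp, ← toStable_add, ← toStable_id]
      exact congrArg toStable (Submodule.projection_add_projection_eq_id hc)
    rw [Preadditive.add_comp, Category.assoc, Category.assoc, hψ, hψ', ← Category.assoc,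
      ← Category.assoc, ← Category.assoc, ← Category.assoc, ← Preadditive.add_comp,
      ← Preadditive.add_comp, h1, Category.id_comp]

/-- In the stable category, adding a free summand does not change a module. -/
lemma exists_iso_prod_free [Module.Finite k A] (Z : StMod k A) (n : ℕ) :
    ∃ e : (⟨Z × free k A n⟩ : StMod k A) ≅ Z,
      e.hom = toStable (M := ⟨Z × free k A n⟩) (LinearMap.fst A Z (free k A n)) := by
  let B : StMod k A := ⟨Z × free k A n⟩
  let a : B →ₗ[A] Z := LinearMap.fst A Z (free k A n)
  let b : Z →ₗ[A] B := LinearMap.inl A Z (free k A n)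
  refine ⟨⟨toStable a, toStable b, ?_, ?_⟩, rfl⟩
  · rw [← toStable_comp, ← toStable_id, toStable_eq_iff]
    refine ⟨free k A n, LinearMap.snd A Z (free k A n), -LinearMap.inr A Z (free k A n),
      inferInstanceAs (Module.Projective A (Fin n → A)), LinearMap.ext fun x => ?_⟩
    change ((x.1, 0) : Z × free k A n) - x = -(0, x.2)
    refine Prod.ext ?_ ?_
    · exact (sub_self x.1).trans neg_zero.symm
    · exact zero_sub x.2
  · rw [← toStable_comp, ← toStable_id]
    rfl

/-- Every object of the stable category has an approximation by an object of `F(S)`. -/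
lemma exists_approximation [Module.Finite k A] (hinj : Module.Injective A A)
    (hemb : ∀ M : StMod k A, ∃ (n : ℕ) (ι : M →ₗ[A] free k A n), Function.Injective ι)
    {n : ℕ} {X : Fin n → StMod k A}
    (hX : ∀ M : StMod k A, M.IsIndecomposable → ∃ i, Nonempty (M ≃ₗ[A] X i))
    {S : ObjectProperty (StMod k A)} (hS : IsOrthogonalSystem S) (Z : StMod k A) :
    ∃ (F Y C : StMod k A) (i : F →ₗ[A] Y) (p : Y →ₗ[A] C),
      Function.Injective i ∧ Function.Exact i p ∧ Function.Surjective p ∧ Nonempty (Y ≅ Z) ∧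
      extClosure S F ∧ InjectiveOn S (toStable i) ∧ S.rightOrthogonal C := by
  let ρ (F : StMod k A) (f : F ⟶ Z) (i : Fin n) : Submodule k (X i ⟶ Z) :=
    LinearMap.range (Linear.rightComp k (X i) f)
  -- The dimensions of `F` itself need not be bounded, but those of the images inside the fixed
  -- spaces `X i ⟶ Z` are.
  let T : Set ℕ := {r | ∃ (F : StMod k A) (f : F ⟶ Z), extClosure S F ∧ InjectiveOn S f ∧
    r = ∑ i, Module.finrank k (ρ F f i)}
  have hT0 : T.Nonempty := by
    let O : StMod k A := ⟨PUnit⟩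
    have hO : IsZero O := (isZero_iff_projective _).2
      (inferInstanceAs (Module.Projective A PUnit.{u + 1}))
    exact ⟨_, O, 0, ⟨0, hO⟩, fun M _ φ _ => hO.eq_of_tgt _ _, rfl⟩
  have hTb : BddAbove T := by
    refine ⟨∑ i, Module.finrank k (X i ⟶ Z), ?_⟩
    rintro _ ⟨F, f, -, -, rfl⟩
    exact Finset.sum_le_sum fun i _ => Submodule.finrank_le _
  obtain ⟨F, f, hF, hf, hmax⟩ := Nat.sSup_mem hT0 hTb
  obtain ⟨f₀, rfl⟩ := toStable_surjective f
  obtain ⟨m, ι, hι⟩ := hemb F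
  let Y : StMod k A := ⟨Z × free k A m⟩
  obtain ⟨e, he⟩ := exists_iso_prod_free Z m
  -- The free summand makes `f₀` injective without changing it stably.
  let i : F →ₗ[A] Y := f₀.prod ι
  have hi : Function.Injective i := fun x y h => hι (congrArg Prod.snd h)
  let p : Y →ₗ[A] Y.quot (LinearMap.range i) := (LinearMap.range i).mkQ
  have hp : Function.Surjective p := Submodule.mkQ_surjective _
  have hip : Function.Exact i p := LinearMap.exact_map_mkQ_range i
  have hie : toStable i ≫ e.hom = toStable f₀ := by
    rw [he, ← toStable_comp]
    rfl
  have hiS : InjectiveOn S (toStable i) := fun M hM φ hφ =>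
    hf M hM φ (by rw [← hie, reassoc_of% hφ, zero_comp])
  refine ⟨F, Y, _, i, p, hi, hip, hp, ⟨e⟩, hF, hiS, fun M s hM => ?_⟩
  by_contra hs
  obtain ⟨s, rfl⟩ := toStable_surjective s
  obtain ⟨E, j, r, hE, hr, hjr, hno⟩ :=
    exists_larger_approximation hinj hS hi hip hp hF hiS hM s hs
  have hle : ∀ l, ρ F (toStable f₀) l ≤ ρ E (r ≫ e.hom) l := by
    rintro l _ ⟨φ, rfl⟩
    exact ⟨φ ≫ j, by simp [reassoc_of% hjr, hie]⟩
  have hrank : ∀ l ∈ Finset.univ,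
      Module.finrank k (ρ F (toStable f₀) l) ≤ Module.finrank k (ρ E (r ≫ e.hom) l) :=
    fun l _ => Submodule.finrank_mono (hle l)
  have hsum : ∑ l, Module.finrank k (ρ E (r ≫ e.hom) l) ≤
      ∑ l, Module.finrank k (ρ F (toStable f₀) l) := by
    rw [← hmax]
    refine le_csSup hTb ⟨E, r ≫ e.hom, hE, fun M hM φ hφ => hr M hM φ ?_, rfl⟩
    rw [← cancel_mono e.hom, Category.assoc, hφ, zero_comp]
  -- Maximality makes every image equal, so all maps from the `X l`, hence from every module,
  -- factor; the identity of `E` then gives the forbidden factorization of `r`.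
  have heq := (Finset.sum_eq_sum_iff_of_le hrank).1
    (le_antisymm (Finset.sum_le_sum hrank) hsum)
  have hfac : ∀ l, ∀ φ : X l ⟶ E, ∃ ψ : X l ⟶ F, ψ ≫ toStable f₀ = φ ≫ (r ≫ e.hom) := by
    intro l φ
    have h1 := Submodule.eq_of_le_of_finrank_eq (hle l) (heq l (Finset.mem_univ l))
    have h2 : φ ≫ (r ≫ e.hom) ∈ ρ F (toStable f₀) l := h1 ▸ ⟨φ, rfl⟩
    exact h2
  obtain ⟨g, hg⟩ := exists_comp_eq_of_indecomposables hX hfac E (𝟙 E)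
  refine hno ⟨g, ?_⟩
  rw [← cancel_mono e.hom, Category.assoc, hie, hg, Category.id_comp]

/-! ### Vanishing of the orthogonals and conclusion -/

/-- Nakayama stability turns injectivity on maps from `S` into vanishing of maps to `S` on the
cokernel. -/
lemma leftOrthogonal_of_injectiveOn [Module.Finite k A]
    (hemb : ∀ M : StMod k A, ∃ (n : ℕ) (ι : M →ₗ[A] free k A n), Function.Injective ι)
    {S : ObjectProperty (StMod k A)} (hν : IsNakayamaStable S) {X Y Z : StMod k A}
    {i : X →ₗ[A] Y} {p : Y →ₗ[A] Z} (hi : Function.Injective i) (hip : Function.Exact i p)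
    (hp : Function.Surjective p) (hiS : InjectiveOn S (toStable i)) (hY : S.leftOrthogonal Y) :
    S.leftOrthogonal Z := by
  intro N φ hN
  obtain ⟨M, hM, ⟨e⟩⟩ := hν.surj N hN
  obtain ⟨n, ι, hι⟩ := hemb Z
  obtain ⟨ψ, hψ⟩ := toStable_surjective (φ ≫ e.inv)
  have h0 : toStable ψ = 0 := by
    refine toStable_eq_zero_of_comp_nakayama hi hip hp hι (fun h hh => hiS M hM _ hh) ?_
    rw [toStable_comp, hψ, ← Category.assoc, hY (toStable p ≫ φ) hN, zero_comp]
  rw [← cancel_mono e.inv, ← hψ, h0, zero_comp]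

/-- In a short exact sequence with projective cokernel, the injection is a stable retraction. -/
lemma exists_retraction_of_isZero {X Y Z : StMod k A} {i : X →ₗ[A] Y} {p : Y →ₗ[A] Z}
    (hi : Function.Injective i) (hip : Function.Exact i p) (hp : Function.Surjective p)
    (hZ : IsZero Z) : ∃ ρ : Y ⟶ X, ρ ≫ toStable i = 𝟙 Y :=
  (isTrianglePair_of_exact hi hip hp).exists_comp_eq (𝟙 Y) (hZ.eq_of_tgt _ _)

lemma isZero_of_exact {X Y Z : StMod k A} {i : X →ₗ[A] Y} {p : Y →ₗ[A] Z}
    (hi : Function.Injective i) (hip : Function.Exact i p) (hp : Function.Surjective p)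
    (hY : IsZero Y) (hZ : IsZero Z) : IsZero X := by
  rw [isZero_iff_projective] at hY hZ ⊢
  obtain ⟨s, hs⟩ := Module.projective_lifting_property p LinearMap.id hp
  obtain ⟨t, ht⟩ := exists_comp_eq_of_exact hi hip (f := LinearMap.id - s ∘ₗ p) (by
    rw [LinearMap.comp_sub, ← LinearMap.comp_assoc, hs, LinearMap.id_comp, LinearMap.comp_id,
      sub_self])
  refine Module.Projective.of_split i t (LinearMap.ext fun x => hi ?_)
  have := LinearMap.congr_fun ht (i x)
  simpa [hip.apply_apply_eq_zero] using this

end StMod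

theorem corollary3 {k A : Type u} [Field k] [IsAlgClosed k] [Ring A] [Algebra k A]
    [Module.Finite k A] (hA : IsRFSAlgebra k A)
    (S : ObjectProperty (StMod k A)) (hS : StMod.IsOrthogonalSystem S)
    (hν : StMod.IsNakayamaStable S)
    (hperp : ∀ X : StMod k A, S.leftOrthogonal X → S.rightOrthogonal X → IsZero X) :
    StMod.IsSimpleMindedSystem S := by
  refine ⟨hS, fun Z => ?_⟩
  have hinj := hA.selfInjective
  -- Basicness enters only through commutativity of `A` modulo its radical.
  have hcomm : ∀ a b : A, a * b - b * a ∈ Ring.jacobson A := by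
    obtain ⟨n, ⟨e⟩⟩ := hA.basic
    intro a b
    rw [← Ideal.Quotient.eq]
    refine e.injective ?_
    rw [map_mul, map_mul, map_mul, map_mul, mul_comm]
  have hemb := StMod.exists_injective_to_free (k := k) hinj hcomm
  obtain ⟨n, X, hX⟩ := hA.representationFinite
  have left : ∀ Z : StMod k A, S.leftOrthogonal Z → IsZero Z := by
    intro Z hZ
    obtain ⟨F, Y, C, i, p, hi, hip, hp, ⟨e⟩, hF, hiS, hC⟩ :=
      StMod.exists_approximation hinj hemb hX hS Z
    have hY : S.leftOrthogonal Y := S.leftOrthogonal.prop_of_iso e.symm hZ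
    have hC0 := hperp C (StMod.leftOrthogonal_of_injectiveOn hemb hν hi hip hp hiS hY) hC
    obtain ⟨ρ, hρ⟩ := StMod.exists_retraction_of_isZero hi hip hp hC0
    refine IsZero.of_iso ((IsZero.iff_id_eq_zero Y).2 ?_) e.symm
    rw [← hρ, StMod.eq_zero_of_leftOrthogonal hY hF ρ, zero_comp]
  have right : ∀ X : StMod k A, S.rightOrthogonal X → IsZero X := by
    intro X hX
    obtain ⟨m, i, hi⟩ := hemb X
    let I := StMod.free k A m
    have hI : IsZero I :=
      (StMod.isZero_iff_projective I).2 (inferInstanceAs (Module.Projective A (Fin m → A)))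
    have hip : Function.Exact i (LinearMap.range i).mkQ := LinearMap.exact_map_mkQ_range i
    have hp := Submodule.mkQ_surjective (LinearMap.range i)
    -- The quotient is the cosyzygy of `X`. Injectivity on `S` is trivial because `Hom(S, X) = 0`,
    -- and `Hom(I, S) = 0` because `I` is projective.
    have hC := left (I.quot (LinearMap.range i))
      (StMod.leftOrthogonal_of_injectiveOn hemb hν hi hip hp (fun M hM φ _ => hX φ hM)
        fun N φ _ => hI.eq_of_src _ _)
    exact StMod.isZero_of_exact hi hip hp hI hC
  obtain ⟨F, Y, C, i, p, hi, hip, hp, ⟨e⟩, hF, hiS, hC⟩ :=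
    StMod.exists_approximation hinj hemb hX hS Z
  obtain ⟨m, hm⟩ := hF
  exact StMod.extClosure_of_iso e
    ⟨m + 1, F, C, _, _, hm, Or.inr (right C hC), StMod.isTrianglePair_of_exact hi hip hp⟩
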